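/- Let $G$ be a finite soluble group. For a subgroup $A$ of $G$ let $A^G$ denote the normal closure of $A$ in $G$ and $A_G=\bigcap_{x\in G}A^x$ its normal core. A chief factor of $G$ is a quotient $H/K$ with $K<H$ normal subgroups of $G$ such that no normal subgroup of $G$ lies strictly between $K$ and $H$; it is central if $H/K\le Z(G/K)$. A subgroup $A$ is S-permutable in $G$ if $AP=PA$ for every Sylow subgroup $P$ of $G$, and $G$ is a PST-group if every subnormal subgroup of $G$ is S-permutable in $G$. Let $\Delta$ be the set of all central chief factors of $G$; let $\mathcal L_{\mathfrak N}(G)$ be the set of all subgroups $A$ of $G$ with $A^G/A_G$ nilpotent, and let $\mathcal L_\Delta(G)$ be the set of all subgroups $A$ of $G$ such that either $A_G=A^G$, or $A_G<A^G$ and every chief factor $H/K$ of $G$ with $A_G\le K<H\le A^G$ belongs to $\Delta$. Then $G$ is a PST-group if and only if $\mathcal L_{\mathfrak N}(G)=\mathcal L_\Delta(G)$. Equivalently, $G$ is a PST-group if and only if $A^G/A_G\le Z_\infty(G/A_G)$ for every subgroup $A$ of $G$ with $A^G/A_G$ nilpotent, where $Z_\infty(X)$ denotes the hypercentre of $X$,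 i.e. the last term of the upper central series of the finite group $X$. -/

import Mathlib

/-- A normal section `top / bot` of `G`: a pair of normal subgroups `bot ≤ top` of `G`. -/
structure NormalSection (G : Type*) [Group G] where
  top : Subgroup G
  bot : Subgroup G
  top_normal : top.Normal
  bot_normal : bot.Normal
  bot_le_top : bot ≤ top

namespace NormalSection

variable {G : Type*} [Group G]

instance (S : NormalSection G) : S.top.Normal := S.top_normal

instance (S : NormalSection G) : S.bot.Normal := S.bot_normal

/-- The quotient group `top / bot`. -/
abbrev Quot (S : NormalSection G) : Type _ :=
  S.top ⧸ S.bot.subgroupOf S.top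

/-- `top / bot` as a subgroup of `G / bot`. -/
def image (S : NormalSection G) : Subgroup (G ⧸ S.bot) :=
  S.top.map (QuotientGroup.mk' S.bot)

/-- `H / K` is a chief factor of `G`: `K < H`, and no normal subgroup of `G` lies strictly
between `K` and `H`. -/
def IsChiefFactor (S : NormalSection G) : Prop :=
  S.bot < S.top ∧
    ∀ N : Subgroup G, N.Normal → S.bot ≤ N → N ≤ S.top → N = S.bot ∨ N = S.top

/-- `H / K` is central: `H / K ≤ Z(G / K)`. -/
def IsCentral (S : NormalSection G) : Prop :=
  S.image ≤ Subgroup.center (G ⧸ S.bot)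

/-- `T / L ≤ Z_Δ(G)`: either `L = T`, or `L < T` and every chief factor of `G` between `L` and
`T` belongs to `Δ`. -/
def LeZ (S : NormalSection G) (Δ : Set (NormalSection G)) : Prop :=
  S.bot = S.top ∨
    (S.bot < S.top ∧
      ∀ C : NormalSection G, C.IsChiefFactor → S.bot ≤ C.bot → C.top ≤ S.top → C ∈ Δ)

end NormalSection

/-- The set of all central chief factors of `G`. -/
def centralChiefFactors (G : Type*) [Group G] : Set (NormalSection G) :=
  {S | S.IsChiefFactor ∧ S.IsCentral}

/-- The section `A^G / A_G`: the normal closure of `A` in `G` modulo the normal core of `A`. -/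
def closureModCore {G : Type*} [Group G] (A : Subgroup G) : NormalSection G where
  top := Subgroup.normalClosure (A : Set G)
  bot := A.normalCore
  top_normal := inferInstance
  bot_normal := inferInstance
  bot_le_top := A.normalCore_le.trans Subgroup.le_normalClosure

/-- `L_Δ(G)`: the subgroups `A` of `G` with `A^G / A_G ≤ Z_Δ(G)`. -/
def latticeOfSections (G : Type*) [Group G] (Δ : Set (NormalSection G)) : Set (Subgroup G) :=
  {A | (closureModCore A).LeZ Δ}

/-- `L_𝔑(G)`: the subgroups `A` of `G` with `A^G / A_G` nilpotent. -/
def latticeOfNilpotent (G : Type*) [Group G] : Set (Subgroup G) :=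
  {A | Group.IsNilpotent (closureModCore A).Quot}

/-- The hypercentre `Z_∞(G)` of a finite group: the union of the upper central series. -/
def hypercenter (G : Type*) [Group G] : Subgroup G :=
  ⨆ n : ℕ, Subgroup.upperCentralSeries G n

open scoped Pointwise in
/-- `A` is S-permutable in `G`: `A P = P A` for every Sylow subgroup `P` of `G`. -/
def IsSPermutable {G : Type*} [Group G] (A : Subgroup G) : Prop :=
  ∀ p : ℕ, p.Prime → ∀ P : Sylow p G, (A : Set G) * (P : Set G) = (P : Set G) * (A : Set G)

/-- `G` is a PST-group: every subnormal subgroup of `G` is S-permutable in `G`. -/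
def IsPSTGroup (G : Type*) [Group G] : Prop :=
  ∀ A : Subgroup G, A.IsSubnormal → IsSPermutable A

/-! Both characterisations pass through `HasInvariantPrimeSections`. Permutability implies it
because a subnormal `p`-subgroup lies in a normal `p`-subgroup, which meets Sylow `q`-subgroups
trivially for `q ≠ p`. Hypercentrality implies it because `p'`-elements centralise the `p`-elements
of the hypercentre.

Conversely, the invariance makes `G'` nilpotent, so modulo a normal `p'`-subgroup `G'` is a
`p`-group and the Sylow `p`-subgroup is normal. A `p'`-element induces a power automorphism on it;
if this is nontrivial, the Sylow subgroup is abelian (`commute_of_power_automorphism`) and all its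
subgroups are normal. Hence a dichotomy for a normal `p`-subgroup `N`: either all `p'`-elements
centralise `N`, which is then hypercentral (`le_hypercenter_of_centralized`), or every subgroup of
`N` is normal in `G` (`HasInvariantPrimeSections.normal_of_le`).

On the primary parts of a nilpotent `A^G/A_G`, the second case forces the relevant elements of `A`
into `A_G`, so the section is hypercentral. A similar argument shows that every subgroup of the
nilpotent residual of `G` is normal, which reduces S-permutability of a subnormal subgroup to the
nilpotent case. For lattices: a section is hypercentral exactly when its chief factors are central,
and then it is nilpotent. -/

open scoped Pointwise commutatorElement

universe u

/-! ### Elements of prime power order and normal `p`-subgroups. -/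

section PElements

variable {G : Type*} [Group G]

/-- If a prime `q` divided `|K : H ∩ K|`, a Sylow `q`-subgroup of `K` would still lie in `H`. -/
theorem le_of_prime_pow_elements_mem [Finite G] {H K : Subgroup G}
    (h : ∀ q : ℕ, q.Prime → ∀ y ∈ K, (∃ k : ℕ, y ^ q ^ k = 1) → y ∈ H) : K ≤ H := by
  rw [← Subgroup.relIndex_eq_one]
  by_contra hne
  obtain ⟨q, hq, hdvd⟩ := Nat.exists_prime_and_dvd hne
  have := Fact.mk hq
  obtain ⟨Q⟩ : Nonempty (Sylow q K) := inferInstance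
  have hle : (Q : Subgroup K) ≤ H.subgroupOf K := by
    intro y hy
    obtain ⟨k, hk⟩ := Q.isPGroup' ⟨y, hy⟩
    refine h q hq y y.2 ⟨k, ?_⟩
    simpa [Subtype.ext_iff] using hk
  exact Q.not_dvd_index (hdvd.trans (Subgroup.index_dvd_of_le hle))

theorem eq_top_of_forall_sylow_le [Finite G] {H : Subgroup G}
    (h : ∀ q : ℕ, q.Prime → ∃ Q : Sylow q G, (Q : Subgroup G) ≤ H) : H = ⊤ := by
  rw [← Subgroup.index_eq_one]
  by_contra hne
  obtain ⟨q, hq, hdvd⟩ := Nat.exists_prime_and_dvd hne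
  have := Fact.mk hq
  obtain ⟨Q, hQ⟩ := h q hq
  exact Q.not_dvd_index (hdvd.trans (Subgroup.index_dvd_of_le hQ))

theorem normal_of_forall_prime_pow_zpowers_normal [Finite G] {H : Subgroup G}
    (h : ∀ q : ℕ, q.Prime → ∀ y ∈ H, (∃ k : ℕ, y ^ q ^ k = 1) → (Subgroup.zpowers y).Normal) :
    H.Normal := by
  refine ⟨fun a ha g => ?_⟩
  have : H ≤ H.comap (MulAut.conj g).toMonoidHom := by
    refine le_of_prime_pow_elements_mem fun q hq y hy hk => ?_
    have := (h q hq y hy hk).conj_mem y (Subgroup.mem_zpowers y) g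
    exact (Subgroup.zpowers_le.2 hy) this
  exact this ha

/-- Normalisers grow strictly in a nilpotent group, so the induction climbs from `H` to its
normaliser. -/
theorem isSubnormal_of_isNilpotent [Finite G] [Group.IsNilpotent G] (H : Subgroup G) :
    H.IsSubnormal := by
  induction H using WellFoundedGT.induction with
  | _ H ih =>
    by_cases hH : H = ⊤
    · exact hH ▸ Subgroup.IsSubnormal.top
    · have := Group.normalizerCondition_of_isNilpotent (G := G) H (lt_top_iff_ne_top.2 hH)
      exact .step H _ Subgroup.le_normalizer (ih _ this) inferInstance

theorem isSubnormal_of_le_isNilpotent [Finite G] {H K : Subgroup G} (hHK : H ≤ K)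
    (hK : K.IsSubnormal) [Group.IsNilpotent K] : H.IsSubnormal :=
  Subgroup.IsSubnormal.trans hHK (isSubnormal_of_isNilpotent _) hK

theorem card_lt_of_lt_top [Finite G] {K : Subgroup G} (h : K < ⊤) : Nat.card K < Nat.card G :=
  lt_of_le_of_ne (Nat.le_of_dvd Nat.card_pos (Subgroup.card_subgroup_dvd_card K))
    fun he => h.ne (Subgroup.eq_top_of_card_eq K he)

theorem isPGroup_subgroup_iff {p : ℕ} {H : Subgroup G} :
    IsPGroup p H ↔ ∀ h ∈ H, ∃ k : ℕ, h ^ p ^ k = 1 := by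
  simp [isPGroup_iff_pow_pow_eq_one, Subtype.ext_iff]

theorem isPGroup_zpowers {p k : ℕ} {a : G} (h : a ^ p ^ k = 1) :
    IsPGroup p (Subgroup.zpowers a) := by
  rw [isPGroup_subgroup_iff]
  rintro _ ⟨i, rfl⟩
  refine ⟨k, ?_⟩
  rw [← zpow_natCast, ← zpow_mul, mul_comm, zpow_mul, zpow_natCast, h, one_zpow]

theorem isPGroup_quotient_iff {p : ℕ} {N : Subgroup G} [N.Normal] {B : Subgroup G} :
    IsPGroup p (B.map (QuotientGroup.mk' N)) ↔ ∀ b ∈ B, ∃ k : ℕ, b ^ p ^ k ∈ N := by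
  rw [isPGroup_subgroup_iff]
  constructor
  · intro h b hb
    obtain ⟨k, hk⟩ := h _ ⟨b, hb, rfl⟩
    exact ⟨k, (QuotientGroup.eq_one_iff _).1 hk⟩
  · rintro h _ ⟨b, hb, rfl⟩
    obtain ⟨k, hk⟩ := h b hb
    exact ⟨k, (QuotientGroup.eq_one_iff _).2 hk⟩

/-- The intersection of all Sylow `p`-subgroups is characteristic. -/
instance characteristic_iInf_sylow (p : ℕ) :
    (⨅ P : Sylow p G, (P : Subgroup G)).Characteristic := by
  rw [Subgroup.characteristic_iff_le_comap]
  intro φ x hx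
  simp only [Subgroup.mem_comap, Subgroup.mem_iInf] at hx ⊢
  intro P
  exact hx (P.comapOfInjective φ.toMonoidHom φ.injective
    (fun y _ => ⟨φ.symm y, by simp⟩))

/-- Apply induction inside a proper normal `K` containing `B`; the intersection of the Sylow
`p`-subgroups of `K` is characteristic in `K`, hence normal in `G`. -/
theorem exists_normal_isPGroup_of_isSubnormal_aux (p n : ℕ) : ∀ (G : Type u) [Group G] [Finite G]
    (B : Subgroup G), Nat.card G = n → B.IsSubnormal → IsPGroup p B →
    ∃ N : Subgroup G, N.Normal ∧ IsPGroup p N ∧ B ≤ N := by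
  induction n using Nat.strong_induction_on with
  | _ n ih =>
    intro G _ _ B hn hB hp
    rcases hB.lt_normal with rfl | ⟨K, hK, hBK, hlt⟩
    · exact ⟨⊤, inferInstance, hp, le_rfl⟩
    · obtain ⟨N, hN, hNp, hBN⟩ := ih (Nat.card K)
        (hn ▸ card_lt_of_lt_top hlt) K (B.subgroupOf K) rfl hB.subgroupOf
        (hp.comap_subtype)
      let E : Subgroup K := ⨅ P : Sylow p K, (P : Subgroup K)
      have hNE : N ≤ E := le_iInf fun P => hNp.le_sylow_of_normal P
      have hE : IsPGroup p E := by
        obtain ⟨P⟩ : Nonempty (Sylow p K) := inferInstance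
        exact P.isPGroup'.to_le (iInf_le _ P)
      refine ⟨E.map K.subtype, inferInstance, hE.map _, ?_⟩
      rw [← Subgroup.map_subgroupOf_eq_of_le hBK]
      exact Subgroup.map_mono (hBN.trans hNE)

theorem exists_normal_isPGroup_of_isSubnormal [Finite G] {p : ℕ} {B : Subgroup G}
    (hB : B.IsSubnormal) (hp : IsPGroup p B) :
    ∃ N : Subgroup G, N.Normal ∧ IsPGroup p N ∧ B ≤ N :=
  exists_normal_isPGroup_of_isSubnormal_aux p _ G B rfl hB hp

/-- In a normal nilpotent subgroup the `p`-elements lie in a normal `p`-subgroup contained in it. -/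
theorem exists_normal_isPGroup_le [Finite G] {p : ℕ} [Fact p.Prime] (T : Subgroup G) [T.Normal]
    [Group.IsNilpotent T] : ∃ N : Subgroup G, N.Normal ∧ IsPGroup p N ∧ N ≤ T ∧
      (∀ a ∈ T, (∃ k : ℕ, a ^ p ^ k = 1) → a ∈ N) ∧ (p ∣ Nat.card T → N ≠ ⊥) := by
  obtain ⟨P⟩ : Nonempty (Sylow p T) := inferInstance
  have : (P : Subgroup T).Characteristic := P.characteristic_of_normal inferInstance
  refine ⟨(P : Subgroup T).map T.subtype, inferInstance, P.isPGroup'.map _,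
    Subgroup.map_subtype_le _, ?_, ?_⟩
  · rintro a ha ⟨k, hk⟩
    have h1 : IsPGroup p (Subgroup.zpowers (⟨a, ha⟩ : T)) :=
      isPGroup_zpowers (k := k) (by simpa [Subtype.ext_iff] using hk)
    have h2 : Subgroup.zpowers (⟨a, ha⟩ : T) ≤ P := by
      obtain ⟨Q, hQ⟩ := h1.exists_le_sylow
      have := P.unique_of_normal inferInstance
      rwa [Subsingleton.elim Q P] at hQ
    exact ⟨⟨a, ha⟩, h2 (Subgroup.mem_zpowers _), rfl⟩
  · intro hd hbot
    rw [Subgroup.map_eq_bot_iff_of_injective _ T.subtype_injective] at hbot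
    have h1 := P.not_dvd_index
    rw [hbot, Subgroup.index_bot] at h1
    exact h1 hd

/-- A nontrivial normal `p`-subgroup meets the centre of any Sylow `p`-subgroup. -/
theorem exists_orderOf_eq_prime_mem_centralizer [Finite G] {p : ℕ} [Fact p.Prime]
    {N : Subgroup G} [N.Normal] (hN : IsPGroup p N) (hne : N ≠ ⊥) (P : Sylow p G) :
    ∃ z ∈ N, orderOf z = p ∧ ∀ g ∈ P, g * z = z * g := by
  let : MulAction P N := MulAction.compHom N ((MulAut.conjNormal (H := N)).comp
    (P : Subgroup G).subtype)
  have hsm : ∀ (g : P) (a : N), ((g • a : N) : G) = g * a * (g : G)⁻¹ := fun g a => rfl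
  have hdvd : p ∣ Nat.card N := by
    rcases hN.card_eq_or_dvd with h | h
    · exact absurd (Subgroup.card_eq_one.1 h) hne
    · exact h
  have h1 : (1 : N) ∈ MulAction.fixedPoints P N := by
    intro g
    ext
    simp [hsm]
  obtain ⟨b, hb, hb1⟩ := P.isPGroup'.exists_fixed_point_of_prime_dvd_card_of_fixed_point N hdvd h1
  have hbG : (b : G) ≠ 1 := fun h => hb1 (by ext; exact h.symm)
  obtain ⟨k, hk⟩ := (IsPGroup.iff_orderOf.1 hN) b
  have hk0 : k ≠ 0 := by
    rintro rfl
    rw [pow_zero, orderOf_eq_one_iff] at hk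
    exact hb1 hk.symm
  refine ⟨(b : G) ^ p ^ (k - 1), N.pow_mem b.2 _, ?_, fun g hg => ?_⟩
  · rw [orderOf_pow, Subgroup.orderOf_coe, hk,
      Nat.gcd_eq_right (pow_dvd_pow p (Nat.sub_le k 1)), Nat.pow_div (Nat.sub_le k 1)
      (Fact.out : p.Prime).pos]
    have : k - (k - 1) = 1 := by omega
    rw [this, pow_one]
  · have h2 : g * b * g⁻¹ = (b : G) := by
      have := congrArg Subtype.val (hb ⟨g, hg⟩)
      rwa [hsm] at this
    have h3 : Commute g (b : G) := mul_inv_eq_iff_eq_mul.1 h2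
    exact h3.pow_right _

end PElements

/-! ### Power automorphisms of `p`-groups. -/

section PowerAutomorphism

variable {P : Type*} [Group P] {p : ℕ}

theorem zpow_ne_one_of_isPGroup [Fact p.Prime] (hP : IsPGroup p P) {a : P} {i : ℤ}
    (hi : ¬ (p : ℤ) ∣ i) (h : a ^ i = 1) : a = 1 := by
  obtain ⟨j, hj⟩ := IsPGroup.iff_orderOf.1 hP a
  have h1 : ((orderOf a : ℕ) : ℤ) ∣ i := orderOf_dvd_iff_zpow_eq_one.2 h
  rw [hj] at h1
  rcases j with _ | j
  · rwa [pow_zero, orderOf_eq_one_iff] at hj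
  · have h2 : (p : ℤ) ∣ ((p ^ (j + 1) : ℕ) : ℤ) := by
      exact_mod_cast dvd_pow_self p (Nat.succ_ne_zero j)
    exact absurd (h2.trans h1) hi

theorem mem_zpowers_of_zpow_mem {z b : P} [Fact p.Prime] (hb : orderOf b = p) {i : ℤ}
    (hi : ¬ (p : ℤ) ∣ i) (h : b ^ i ∈ Subgroup.zpowers z) : b ∈ Subgroup.zpowers z := by
  have hc : IsCoprime (p : ℤ) i :=
    (Nat.prime_iff_prime_int.1 (Fact.out : p.Prime)).coprime_iff_not_dvd.2 hi
  obtain ⟨u, v, huv⟩ := hc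
  have h1 : b = (b ^ i) ^ v := by
    have hbp : b ^ (p : ℤ) = 1 := by rw [zpow_natCast, ← hb, pow_orderOf_eq_one]
    rw [← zpow_mul]
    calc b = b ^ (u * p + v * i) := by rw [huv, zpow_one]
      _ = b ^ (i * v) := by rw [zpow_add, mul_comm u, zpow_mul, hbp, one_zpow, one_mul, mul_comm]
  rw [h1]
  exact Subgroup.zpow_mem _ h v

/-- An endomorphism of a `p`-group stabilising every subgroup acts on all elements by powers
whose exponents agree modulo `p`. -/
theorem exists_uniform_exponent [Finite P] [Fact p.Prime] (hP : IsPGroup p P) (φ : P →* P)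
    (hφ : ∀ a, φ a ∈ Subgroup.zpowers a) :
    ∃ k : ℤ, ∀ (a : P) (m : ℤ), φ a = a ^ m → a ≠ 1 → (p : ℤ) ∣ m - k := by
  rcases subsingleton_or_nontrivial P with hs | hs
  · exact ⟨0, fun a m _ h => absurd (Subsingleton.elim a 1) h⟩
  obtain ⟨S⟩ : Nonempty (Sylow p P) := inferInstance
  have htop : IsPGroup p (⊤ : Subgroup P) := hP.to_subgroup _
  -- The uniform exponent is read off from a central element `z` of order `p`.
  obtain ⟨z, -, hz, hcomm⟩ := exists_orderOf_eq_prime_mem_centralizer htop top_ne_bot S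
  replace hcomm : ∀ g, g * z = z * g := fun g =>
    hcomm g (htop.le_sylow_of_normal S (Subgroup.mem_top g))
  obtain ⟨k, hk⟩ := hφ z
  replace hk : φ z = z ^ k := hk.symm
  refine ⟨k, fun a m hm ha => ?_⟩
  obtain ⟨j, hj⟩ := IsPGroup.iff_orderOf.1 hP a
  have hj0 : j ≠ 0 := by
    rintro rfl
    rw [pow_zero, orderOf_eq_one_iff] at hj
    exact ha hj
  obtain ⟨b, hb, hbm⟩ : ∃ b : P, orderOf b = p ∧ φ b = b ^ m := by
    refine ⟨a ^ p ^ (j - 1), ?_, ?_⟩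
    · rw [orderOf_pow, hj, Nat.gcd_eq_right (pow_dvd_pow p (Nat.sub_le j 1)),
        Nat.pow_div (Nat.sub_le j 1) (Fact.out : p.Prime).pos]
      have : j - (j - 1) = 1 := by omega
      rw [this, pow_one]
    · rw [map_pow, hm, ← zpow_natCast, ← zpow_natCast, ← zpow_mul, ← zpow_mul, mul_comm]
  -- The exponent `l` at `z * b` links those at `z` and `b`, unless `b` is a power of `z` and
  -- inherits its exponent.
  obtain ⟨l, hl⟩ := hφ (z * b)
  have hzb : Commute z b := (hcomm b).symm
  have h1 : z ^ l * b ^ l = z ^ k * b ^ m := by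
    rw [← hzb.mul_zpow, ← hk, ← hbm, ← map_mul]
    exact hl
  have h2 : b ^ (m - l) = z ^ (l - k) := by
    rw [zpow_sub, sub_eq_neg_add, zpow_add, zpow_neg, mul_inv_eq_iff_eq_mul, mul_assoc, h1,
      inv_mul_cancel_left]
  by_cases hd : (p : ℤ) ∣ m - l
  · have h3 : b ^ (m - l) = 1 := by
      rw [← orderOf_dvd_iff_zpow_eq_one, hb]; exact hd
    rw [h3] at h2
    have h4 : (p : ℤ) ∣ l - k := by
      rw [← hz]; exact orderOf_dvd_iff_zpow_eq_one.2 h2.symm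
    have := dvd_add hd h4
    rwa [sub_add_sub_cancel] at this
  · obtain ⟨i, hi⟩ := mem_zpowers_of_zpow_mem (z := z) hb hd (h2 ▸ ⟨l - k, rfl⟩)
    have h5 : φ b = b ^ k := by
      have hi' : b = z ^ i := hi.symm
      rw [hi', map_zpow, hk, ← zpow_mul, ← zpow_mul, mul_comm]
    have h6 : b ^ (m - k) = 1 := by
      rw [zpow_sub, ← hbm, h5, mul_inv_cancel]
    rw [← orderOf_dvd_iff_zpow_eq_one, hb] at h6
    exact h6

/-- From `φ ^ n = 1`, the factor `m ^ n - 1 = (m - 1)(1 + m + ⋯ + m ^ (n - 1))` kills `a`. The sum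
is congruent to `n` modulo `p`, hence prime to `p`, so already `a ^ (m - 1) = 1`. -/
theorem mulAut_eq_one_of_exponent_one [Fact p.Prime] (hP : IsPGroup p P) (φ : MulAut P)
    {n : ℕ} (hn : p.Coprime n) (hφn : φ ^ n = 1)
    (h : ∀ a : P, ∃ m : ℤ, (p : ℤ) ∣ m - 1 ∧ φ a = a ^ m) : φ = 1 := by
  ext a
  obtain ⟨m, hm, hφ⟩ := h a
  have hpow : ∀ i : ℕ, (φ ^ i) a = a ^ (m ^ i) := by
    intro i
    induction i with
    | zero => simp
    | succ i ih =>
      rw [pow_succ, MulAut.mul_apply, hφ, map_zpow, ih, ← zpow_mul, pow_succ]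
  have h1 : (a ^ (m - 1)) ^ (∑ i ∈ Finset.range n, m ^ i) = 1 := by
    rw [← zpow_mul, mul_comm, geom_sum_mul, zpow_sub, ← hpow, hφn]
    simp
  have h2 : ¬ (p : ℤ) ∣ ∑ i ∈ Finset.range n, m ^ i := by
    intro hd
    have h3 : (p : ℤ) ∣ (∑ i ∈ Finset.range n, m ^ i) - ∑ i ∈ Finset.range n, (1 : ℤ) := by
      rw [← Finset.sum_sub_distrib]
      refine Finset.dvd_sum fun i _ => hm.trans ?_
      simpa using sub_dvd_pow_sub_pow m 1 i
    have h4 := (dvd_sub_right hd).1 h3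
    simp only [Finset.sum_const, Finset.card_range, nsmul_eq_mul, mul_one] at h4
    have h5 : p ∣ n := by exact_mod_cast h4
    exact (Fact.out : p.Prime).ne_one (Nat.dvd_one.1 (hn ▸ Nat.dvd_gcd dvd_rfl h5))
  have h3 := zpow_ne_one_of_isPGroup hP h2 h1
  rw [MulAut.one_apply, hφ]
  rwa [zpow_sub, zpow_one, mul_inv_eq_one] at h3

theorem commutatorElement_zpow_zpow {a b : P} (hc : ⁅a, b⁆ ∈ Subgroup.center P) (m l : ℤ) :
    ⁅a ^ m, b ^ l⁆ = ⁅a, b⁆ ^ (l * m) := by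
  set c := ⁅a, b⁆ with hcdef
  have hcc : ∀ g, Commute c g := fun g => (Subgroup.mem_center_iff.1 hc g).symm
  have h1 : a * b * a⁻¹ = c * b := by rw [hcdef, commutatorElement_def]; group
  have h2 : a * b ^ l * a⁻¹ = c ^ l * b ^ l := by
    rw [← conj_zpow, h1, (hcc b).mul_zpow]
  have h3 : b ^ l * a⁻¹ * (b ^ l)⁻¹ = c ^ l * a⁻¹ := by
    have h4 : b ^ l * a⁻¹ = c ^ l * a⁻¹ * b ^ l := by
      have h5 : b ^ l * a⁻¹ = a⁻¹ * (c ^ l * b ^ l) := by rw [← h2]; group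
      rw [h5, ← mul_assoc, (((hcc a⁻¹).zpow_left l).eq).symm]
    rw [h4, mul_inv_cancel_right]
  have h6 : b ^ l * a ^ (-m) * (b ^ l)⁻¹ = c ^ (l * m) * a ^ (-m) := by
    have : a ^ (-m) = a⁻¹ ^ m := by rw [zpow_neg, inv_zpow]
    rw [this, ← conj_zpow, h3, ((hcc a⁻¹).zpow_left l).mul_zpow, zpow_mul]
  rw [commutatorElement_def, mul_assoc, mul_assoc, ← zpow_neg, ← mul_assoc (b ^ l), h6,
    ← mul_assoc, ((hcc (a ^ m)).zpow_left _).eq.symm, mul_assoc, ← zpow_add, add_neg_cancel,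
    zpow_zero, mul_one]

/-- By induction along central quotients `⁅a, b⁆` is central, so `φ` raises it to an exponent
congruent both to `k ^ 2` and to `k` modulo `p`. As `p` does not divide `k (k - 1)`, the commutator
is trivial. -/
theorem commute_of_uniform_exponent [Fact p.Prime] [Group.IsNilpotent P] (hP : IsPGroup p P)
    {k : ℤ} (hk : ¬ (p : ℤ) ∣ k) (hk1 : ¬ (p : ℤ) ∣ k - 1) (φ : P →* P)
    (hφ : ∀ a : P, ∃ m : ℤ, (p : ℤ) ∣ m - k ∧ φ a = a ^ m) (a b : P) : a * b = b * a := by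
  revert φ a b hP
  refine Group.nilpotent_center_quotient_ind (P := fun P _ _ => IsPGroup p P → ∀ φ : P →* P,
    (∀ a : P, ∃ m : ℤ, (p : ℤ) ∣ m - k ∧ φ a = a ^ m) → ∀ a b : P, a * b = b * a) P ?_ ?_
  · intro P _ _ _ _ _ a b
    exact Subsingleton.elim _ _
  · intro P _ _ ih hP φ hφ a b
    have hle : Subgroup.center P ≤ (Subgroup.center P).comap φ := by
      intro z hz
      obtain ⟨m, -, hm⟩ := hφ z
      rw [Subgroup.mem_comap, hm]
      exact Subgroup.zpow_mem _ hz m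
    have hquot := ih (hP.to_quotient _) (QuotientGroup.map _ _ φ hle) (by
      intro x
      induction x using QuotientGroup.induction_on with
      | H x =>
        obtain ⟨m, hmk, hm⟩ := hφ x
        exact ⟨m, hmk, by rw [QuotientGroup.map_mk, hm, QuotientGroup.mk_zpow]⟩) a b
    have hc : ⁅a, b⁆ ∈ Subgroup.center P := by
      rw [← QuotientGroup.eq_one_iff, commutatorElement_def]
      simp only [QuotientGroup.mk_mul, QuotientGroup.mk_inv]
      rw [hquot, mul_inv_cancel_right, mul_inv_cancel]
    obtain ⟨m, hmk, hm⟩ := hφ a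
    obtain ⟨l, hlk, hl⟩ := hφ b
    obtain ⟨s, hsk, hs⟩ := hφ ⁅a, b⁆
    rw [map_commutatorElement, hm, hl, commutatorElement_zpow_zpow hc] at hs
    have h1 : ⁅a, b⁆ ^ (l * m - s) = 1 := by rw [zpow_sub, hs, mul_inv_cancel]
    have h2 : ¬ (p : ℤ) ∣ l * m - s := by
      intro hd
      have h3 : (p : ℤ) ∣ k * (k - 1) := by
        have : k * (k - 1) = (l * m - s) - (l - k) * m - k * (m - k) + (s - k) := by ring
        rw [this]
        exact dvd_add (dvd_sub (dvd_sub hd (hlk.mul_right _)) (hmk.mul_left _)) hsk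
      rcases (Nat.prime_iff_prime_int.1 (Fact.out : p.Prime)).dvd_or_dvd h3 with h | h
      · exact hk h
      · exact hk1 h
    exact commutatorElement_eq_one_iff_mul_comm.1 (zpow_ne_one_of_isPGroup hP h2 h1)

/-- A `p`-group with a nontrivial power automorphism of order prime to `p` is abelian. -/
theorem commute_of_power_automorphism [Finite P] [Fact p.Prime] (hP : IsPGroup p P)
    (φ : MulAut P) {n : ℕ} (hn : p.Coprime n) (hφn : φ ^ n = 1) (hne : φ ≠ 1)
    (hφ : ∀ a, φ a ∈ Subgroup.zpowers a) (a b : P) : a * b = b * a := by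
  have : Group.IsNilpotent P := hP.isNilpotent
  obtain ⟨k, hk⟩ := exists_uniform_exponent hP φ.toMonoidHom hφ
  have hex : ∀ a : P, ∃ m : ℤ, (p : ℤ) ∣ m - k ∧ φ a = a ^ m := by
    intro a
    by_cases ha : a = 1
    · exact ⟨k, by simp, by simp [ha]⟩
    · obtain ⟨m, hm⟩ := hφ a
      exact ⟨m, hk a m hm.symm ha, hm.symm⟩
  refine commute_of_uniform_exponent hP (k := k) ?_ ?_ φ.toMonoidHom hex a b
  -- An exponent divisible by `p` would kill an element of order `p`, against injectivity.
  · intro hd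
    refine hne ?_
    ext x
    by_contra hx
    have hx1 : x ≠ 1 := fun h => hx (by simp [h])
    have hdvd : p ∣ Nat.card P :=
      (hP.dvd_orderOf hx1).trans (orderOf_dvd_natCard x)
    obtain ⟨z, hz⟩ := exists_prime_orderOf_dvd_card' p hdvd
    obtain ⟨m, hm, hφz⟩ := hex z
    have hpm : (p : ℤ) ∣ m := (dvd_sub_left hd).1 hm
    rw [← hz, orderOf_dvd_iff_zpow_eq_one, ← hφz] at hpm
    have hz1 : z = 1 := φ.injective (hpm.trans (map_one φ).symm)
    rw [hz1, orderOf_one] at hz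
    exact (Fact.out : p.Prime).ne_one hz.symm
  · intro hd
    refine hne (mulAut_eq_one_of_exponent_one hP φ hn hφn fun a => ?_)
    obtain ⟨m, hm, hma⟩ := hex a
    exact ⟨m, by simpa using dvd_add hm hd, hma⟩

end PowerAutomorphism

/-! ### The hypercentre and the action of `p'`-elements. -/

section Hypercenter

variable {G : Type*} [Group G]

theorem mem_hypercenter_iff {x : G} :
    x ∈ hypercenter G ↔ ∃ n, x ∈ Subgroup.upperCentralSeries G n :=
  Subgroup.mem_iSup_of_directed (Subgroup.upperCentralSeries_mono G).directed_le

instance hypercenter_normal : (hypercenter G).Normal := by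
  refine ⟨fun x hx g => ?_⟩
  obtain ⟨n, hn⟩ := mem_hypercenter_iff.1 hx
  exact mem_hypercenter_iff.2 ⟨n, Subgroup.Normal.conj_mem inferInstance x hn g⟩

theorem exists_hypercenter_eq [Finite G] :
    ∃ n, hypercenter G = Subgroup.upperCentralSeries G n := by
  obtain ⟨n, hn⟩ := WellFoundedGT.monotone_chain_condition
    (⟨_, Subgroup.upperCentralSeries_mono G⟩ : ℕ →o Subgroup G)
  refine ⟨n, le_antisymm (iSup_le fun m => ?_) (le_iSup (Subgroup.upperCentralSeries G) n)⟩
  rcases le_total n m with h | h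
  · exact (hn m h).ge
  · exact Subgroup.upperCentralSeries_mono G h

/-- The upper central series stabilises, so the hypercentre equals the next term of the series. -/
theorem mem_hypercenter_of_commutator_mem [Finite G] {x : G}
    (h : ∀ y, x * y * x⁻¹ * y⁻¹ ∈ hypercenter G) : x ∈ hypercenter G := by
  obtain ⟨n, hn⟩ := exists_hypercenter_eq (G := G)
  refine mem_hypercenter_iff.2 ⟨n + 1, ?_⟩
  rw [Subgroup.mem_upperCentralSeries_succ_iff]
  intro y
  rw [← hn]
  exact h y

/-- Elements of order prime to `p` centralise the `p`-elements of the hypercentre. -/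
theorem commute_of_mem_hypercenter {p : ℕ} [Fact p.Prime] {V : Subgroup G} [V.Normal]
    (hV : IsPGroup p V) {v x : G} (hv : v ∈ V) (hvz : v ∈ hypercenter G) {n : ℕ}
    (hn : p.Coprime n) (hx : x ^ n = 1) : x * v * x⁻¹ = v := by
  obtain ⟨m, hm⟩ := mem_hypercenter_iff.1 hvz
  induction m generalizing v with
  | zero =>
    rw [Subgroup.upperCentralSeries_zero, Subgroup.mem_bot] at hm
    simp [hm]
  | succ m ih =>
    set c := x * v * x⁻¹ * v⁻¹ with hc
    have hcV : c ∈ V := V.mul_mem (Subgroup.Normal.conj_mem inferInstance v hv x) (V.inv_mem hv)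
    have hcm : c ∈ Subgroup.upperCentralSeries G m := by
      have := (Subgroup.mem_upperCentralSeries_succ_iff.1 hm) x
      have h2 := Subgroup.inv_mem _ this
      convert h2 using 1
      rw [hc]; group
    have hcx : x * c * x⁻¹ = c := ih hcV (mem_hypercenter_iff.2 ⟨m, hcm⟩) hcm
    -- Since `x` fixes `c`, its powers multiply `v` by powers of `c`. Thus `c ^ n = 1`, while `c` is
    -- a `p`-element.
    have hpow : ∀ i : ℕ, x ^ i * v * (x ^ i)⁻¹ = c ^ i * v := by
      intro i
      induction i with
      | zero => simp
      | succ i ihi =>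
        have h1 : x * c ^ i * x⁻¹ = c ^ i := by rw [← conj_pow, hcx]
        have h2 : x * v * x⁻¹ = c * v := by rw [hc]; group
        calc x ^ (i + 1) * v * (x ^ (i + 1))⁻¹ = x * (x ^ i * v * (x ^ i)⁻¹) * x⁻¹ := by
              rw [pow_succ']; group
          _ = (x * c ^ i * x⁻¹) * (x * v * x⁻¹) := by rw [ihi]; group
          _ = c ^ (i + 1) * v := by rw [h1, h2, pow_succ]; group
    have hcn : c ^ n = 1 := by
      have := hpow n
      rw [hx] at this
      simpa using this
    obtain ⟨k, hk⟩ := isPGroup_subgroup_iff.1 hV c hcV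
    have h1 : orderOf c = 1 := by
      have h2 : (p ^ k).Coprime n := hn.pow_left k
      exact Nat.dvd_one.1 (h2 ▸ Nat.dvd_gcd (orderOf_dvd_of_pow_eq_one hk)
        (orderOf_dvd_of_pow_eq_one hcn))
    rw [orderOf_eq_one_iff, hc, mul_inv_eq_one] at h1
    exact h1

/-- Were the image of `N` modulo the hypercentre nontrivial, it would contain an element of order
`p` centralised by a Sylow `p`-subgroup and, by hypothesis, by Sylow subgroups for the other primes:
a nontrivial central element. -/
theorem le_hypercenter_of_centralized [Finite G] {p : ℕ} [Fact p.Prime] {N : Subgroup G}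
    [N.Normal] (hN : IsPGroup p N)
    (h : ∀ (x : G) (n : ℕ), p.Coprime n → x ^ n = 1 → ∀ a ∈ N, x * a * x⁻¹ = a) :
    N ≤ hypercenter G := by
  let f := QuotientGroup.mk' (hypercenter G)
  have hf : Function.Surjective f := QuotientGroup.mk'_surjective _
  have : (N.map f).Normal := Subgroup.Normal.map inferInstance f hf
  rw [← QuotientGroup.ker_mk' (hypercenter G), ← Subgroup.map_eq_bot_iff]
  by_contra hne
  obtain ⟨P⟩ : Nonempty (Sylow p (G ⧸ hypercenter G)) := inferInstance
  obtain ⟨z, ⟨v, hv, rfl⟩, hz, hcomm⟩ :=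
    exists_orderOf_eq_prime_mem_centralizer (hN.map f) hne P
  have htop : Subgroup.centralizer {f v} = ⊤ := by
    refine eq_top_of_forall_sylow_le fun q hq => ?_
    have := Fact.mk hq
    by_cases hqp : q = p
    · subst hqp
      refine ⟨P, fun g hg => ?_⟩
      rw [Subgroup.mem_centralizer_singleton_iff]
      exact hcomm g hg
    · obtain ⟨Q⟩ : Nonempty (Sylow q G) := inferInstance
      refine ⟨Q.mapSurjective hf, ?_⟩
      rintro _ ⟨y, hy, rfl⟩
      obtain ⟨k, hk⟩ := isPGroup_subgroup_iff.1 Q.isPGroup' y hy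
      have := h y (q ^ k) (((Nat.coprime_primes (Fact.out : p.Prime) hq).2
        (Ne.symm hqp)).pow_right k) hk v hv
      rw [Subgroup.mem_centralizer_singleton_iff, ← map_mul, ← map_mul,
        mul_inv_eq_iff_eq_mul.1 this]
  have hvz : v ∈ hypercenter G := by
    refine mem_hypercenter_of_commutator_mem fun y => ?_
    rw [← QuotientGroup.eq_one_iff]
    have h1 : f y ∈ Subgroup.centralizer {f v} := htop ▸ Subgroup.mem_top _
    rw [Subgroup.mem_centralizer_singleton_iff] at h1
    change f (v * y * v⁻¹ * y⁻¹) = 1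
    rw [map_mul, map_mul, map_mul, map_inv, map_inv, ← h1, mul_inv_cancel_right, mul_inv_cancel]
  rw [show f v = 1 from (QuotientGroup.eq_one_iff v).2 hvz, orderOf_one] at hz
  exact (Fact.out : p.Prime).ne_one hz.symm

/-- If some term of the lower central series of `S` lies in the hypercentre, `S` is nilpotent. -/
theorem isNilpotent_of_lowerCentralSeries_le_hypercenter [Finite G] {S : Subgroup G} {n : ℕ}
    (h : S.lowerCentralSeries n ≤ hypercenter G) : Group.IsNilpotent S := by
  obtain ⟨m, hm⟩ := exists_hypercenter_eq (G := G)
  rw [hm] at h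
  suffices ∀ i, i ≤ m → S.lowerCentralSeries (n + i) ≤
      Subgroup.upperCentralSeries G (m - i) by
    rw [Subgroup.isNilpotent_iff_lowerCentralSeries]
    refine ⟨n + m, le_bot_iff.1 ?_⟩
    simpa using this m le_rfl
  intro i
  induction i with
  | zero => intro _; simpa using h
  | succ i ih =>
    intro hi
    rw [← add_assoc, Subgroup.lowerCentralSeries_succ, Subgroup.commutator_le]
    intro x hx y _
    have h1 := ih (by omega) hx
    rw [show m - i = (m - (i + 1)) + 1 by omega, Subgroup.mem_upperCentralSeries_succ_iff] at h1
    exact h1 y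

end Hypercenter

/-- For every prime `p`, every subnormal section `B / N` of `G` that is a `p`-group, with `N` normal
in `G`, is invariant under the elements of `G` of order prime to `p` modulo `N`. -/
def HasInvariantPrimeSections (G : Type*) [Group G] : Prop :=
  ∀ p : ℕ, p.Prime → ∀ N B : Subgroup G, N.Normal → B.IsSubnormal → N ≤ B →
    (∀ b ∈ B, ∃ k : ℕ, b ^ p ^ k ∈ N) →
      ∀ (x : G) (n : ℕ), p.Coprime n → x ^ n ∈ N → ∀ b ∈ B, x * b * x⁻¹ ∈ B

/-! ### Consequences of invariance under `p'`-elements. -/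

section InvariantSections

variable {G : Type*} [Group G]

/-- Allowing an arbitrary normal `N` below `B` is what lets the condition pass to quotients, by
taking preimages. -/
theorem HasInvariantPrimeSections.of_surjective {H : Type*} [Group H]
    (hG : HasInvariantPrimeSections G) {f : G →* H} (hf : Function.Surjective f) :
    HasInvariantPrimeSections H := by
  intro p hp N B hN hB hNB hpB x n hn hx b hb
  obtain ⟨x, rfl⟩ := hf x
  obtain ⟨b, rfl⟩ := hf b
  have := hG p hp (N.comap f) (B.comap f) inferInstance (hB.comap f) (Subgroup.comap_mono hNB)
    (fun c hc => by
      obtain ⟨k, hk⟩ := hpB (f c) hc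
      exact ⟨k, by simpa using hk⟩) x n hn (by simpa using hx) b hb
  simpa using this

theorem HasInvariantPrimeSections.conj_mem (hG : HasInvariantPrimeSections G) {p : ℕ}
    (hp : p.Prime) {B : Subgroup G} (hB : B.IsSubnormal) (hpB : IsPGroup p B) {x : G} {n : ℕ}
    (hn : p.Coprime n) (hx : x ^ n = 1) {b : G} (hb : b ∈ B) : x * b * x⁻¹ ∈ B :=
  hG p hp ⊥ B inferInstance hB bot_le
    (fun c hc => by simpa using isPGroup_subgroup_iff.1 hpB c hc) x n hn (by simpa using hx) b hb

theorem HasInvariantPrimeSections.conj_mem_of_le [Finite G] (hG : HasInvariantPrimeSections G)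
    {p : ℕ} [hp : Fact p.Prime] {N B : Subgroup G} [hN : N.Normal] (hNp : IsPGroup p N)
    (hB : B ≤ N) {x : G} {n : ℕ} (hn : p.Coprime n) (hx : x ^ n = 1) {b : G} (hb : b ∈ B) :
    x * b * x⁻¹ ∈ B := by
  have := hNp.isNilpotent
  exact hG.conj_mem hp.out (isSubnormal_of_le_isNilpotent hB hN.isSubnormal) (hNp.to_le hB) hn hx hb

theorem le_normalizer_of_conj_mem {Q B : Subgroup G}
    (h : ∀ g ∈ Q, ∀ b ∈ B, g * b * g⁻¹ ∈ B) : Q ≤ Subgroup.normalizer (B : Set G) := by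
  intro g hg
  rw [Subgroup.mem_normalizer_iff]
  refine fun b => ⟨h g hg b, fun hb => ?_⟩
  have := h g⁻¹ (Q.inv_mem hg) _ hb
  convert this using 1
  group

/-- A subgroup is normal if it is invariant under some Sylow `p`-subgroup and under all elements of
order prime to `p`. -/
theorem normal_of_conj_mem [Finite G] {p : ℕ} (hp : p.Prime) (P : Sylow p G) {B : Subgroup G}
    (hP : ∀ g ∈ P, ∀ b ∈ B, g * b * g⁻¹ ∈ B)
    (h : ∀ (x : G) (n : ℕ), p.Coprime n → x ^ n = 1 → ∀ b ∈ B, x * b * x⁻¹ ∈ B) : B.Normal := by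
  rw [← Subgroup.normalizer_eq_top_iff]
  refine eq_top_of_forall_sylow_le fun q hq => ?_
  have := Fact.mk hq
  by_cases hqp : q = p
  · subst hqp
    exact ⟨P, le_normalizer_of_conj_mem hP⟩
  · obtain ⟨Q⟩ : Nonempty (Sylow q G) := inferInstance
    refine ⟨Q, le_normalizer_of_conj_mem fun g hg => ?_⟩
    obtain ⟨k, hk⟩ := isPGroup_subgroup_iff.1 Q.isPGroup' g hg
    exact h g _ (((Nat.coprime_primes hp hq).2 (Ne.symm hqp)).pow_right k) hk

/-- Take a primary part of the last nontrivial derived subgroup, which is abelian. -/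
theorem exists_normal_isPGroup_ne_bot [Finite G] [Group.IsSolvable G] [Nontrivial G] :
    ∃ (p : ℕ) (N : Subgroup G), p.Prime ∧ N.Normal ∧ IsPGroup p N ∧ N ≠ ⊥ := by
  classical
  have hex : ∃ n, derivedSeries G n = ⊥ := Group.IsSolvable.solvable
  set n := Nat.find hex with hndef
  have hn : derivedSeries G n = ⊥ := Nat.find_spec hex
  have hn0 : n ≠ 0 := by
    intro h0
    rw [h0, derivedSeries_zero] at hn
    exact top_ne_bot hn
  obtain ⟨m, hm⟩ := Nat.exists_eq_succ_of_ne_zero hn0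
  let T := derivedSeries G m
  have hT : T ≠ ⊥ := Nat.find_min hex (by omega)
  have hTn : Group.IsNilpotent T := by
    refine Subgroup.isNilpotent_of_lowerCentralSeries_eq_bot (n := 1) ?_
    rw [Subgroup.lowerCentralSeries_succ, Subgroup.lowerCentralSeries_zero]
    rw [hm] at hn
    exact hn
  obtain ⟨p, hp, hd⟩ := Nat.exists_prime_and_dvd (fun h => hT (Subgroup.card_eq_one.1 h))
  have := Fact.mk hp
  obtain ⟨N, hN, hNp, -, -, hne⟩ := exists_normal_isPGroup_le (p := p) T
  exact ⟨p, N, hp, hN, hNp, hne hd⟩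

theorem map_commutator_of_surjective {H : Type*} [Group H] {f : G →* H}
    (hf : Function.Surjective f) : (commutator G).map f = commutator H := by
  rw [commutator_def, commutator_def, Subgroup.map_commutator,
    Subgroup.map_top_of_surjective f hf]

/-- Automorphisms of a cyclic group are power maps, so they commute. -/
theorem commutator_le_centralizer_of_isCyclic (B : Subgroup G) [B.Normal] [IsCyclic B] :
    commutator G ≤ Subgroup.centralizer B := by
  have hker : commutator G ≤ (MulAut.conjNormal (H := B)).ker := by
    rw [commutator_def, Subgroup.commutator_le]
    intro g _ h _
    rw [MonoidHom.mem_ker, map_commutatorElement, commutatorElement_eq_one_iff_mul_comm]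
    obtain ⟨m, hm⟩ := MonoidHom.map_cyclic (MulAut.conjNormal (H := B) g).toMonoidHom
    obtain ⟨l, hl⟩ := MonoidHom.map_cyclic (MulAut.conjNormal (H := B) h).toMonoidHom
    refine MulEquiv.ext fun b => ?_
    change MulAut.conjNormal (H := B) g (MulAut.conjNormal (H := B) h b) =
      MulAut.conjNormal (H := B) h (MulAut.conjNormal (H := B) g b)
    have hm' : ∀ c : B, MulAut.conjNormal (H := B) g c = c ^ m := hm
    have hl' : ∀ c : B, MulAut.conjNormal (H := B) h c = c ^ l := hl
    rw [hm', hl', hl', hm', ← zpow_mul, ← zpow_mul, mul_comm]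
  intro g hg
  rw [Subgroup.mem_centralizer_iff]
  intro b hb
  have h1 := DFunLike.congr_fun (MonoidHom.mem_ker.1 (hker hg)) (⟨b, hb⟩ : B)
  have h2 : g * b * g⁻¹ = b := by
    have := congrArg Subtype.val h1
    simpa using this
  exact (mul_inv_eq_iff_eq_mul.1 h2).symm

/-- A subgroup `⟨z⟩` of order `p` central in a Sylow `p`-subgroup is also `p'`-invariant, hence
normal. Induction applies to `G / ⟨z⟩`, and `G'` centralises the cyclic group `⟨z⟩`. -/
theorem isNilpotent_commutator_aux (n : ℕ) : ∀ (G : Type u) [Group G] [Finite G]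
    [Group.IsSolvable G], Nat.card G = n → HasInvariantPrimeSections G →
    Group.IsNilpotent (commutator G) := by
  induction n using Nat.strong_induction_on with
  | _ n ih =>
    intro G _ _ _ hn hG
    rcases subsingleton_or_nontrivial G with hs | hs
    · infer_instance
    obtain ⟨p, N, hp, hN, hNp, hne⟩ := exists_normal_isPGroup_ne_bot (G := G)
    have := Fact.mk hp
    obtain ⟨P⟩ : Nonempty (Sylow p G) := inferInstance
    obtain ⟨z, hz, hzp, hcomm⟩ := exists_orderOf_eq_prime_mem_centralizer hNp hne P
    let B := Subgroup.zpowers z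
    have hBN : B ≤ N := Subgroup.zpowers_le.2 hz
    have hB : B.Normal := by
      refine normal_of_conj_mem hp P ?_ fun x n hn hx b hb => hG.conj_mem_of_le hNp hBN hn hx hb
      rintro g hg _ ⟨i, rfl⟩
      have : g * z ^ i = z ^ i * g := Commute.zpow_right (hcomm g hg) i
      exact ⟨i, by simp [this]⟩
    have hlt : Nat.card (G ⧸ B) < n := by
      rw [← hn, Subgroup.card_eq_card_quotient_mul_card_subgroup B]
      have h1 : Nat.card B = p := by rw [Nat.card_zpowers, hzp]
      rw [h1]
      exact lt_mul_of_one_lt_right Nat.card_pos hp.one_lt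
    have hnil := ih _ hlt (G ⧸ B) rfl (hG.of_surjective (QuotientGroup.mk'_surjective B))
    rw [Subgroup.isNilpotent_iff_lowerCentralSeries] at hnil ⊢
    obtain ⟨m, hm⟩ := hnil
    refine ⟨m + 1, ?_⟩
    rw [← map_commutator_of_surjective (QuotientGroup.mk'_surjective B),
      ← Subgroup.map_lowerCentralSeries, Subgroup.map_eq_bot_iff, QuotientGroup.ker_mk'] at hm
    rw [Subgroup.lowerCentralSeries_succ, Subgroup.commutator_eq_bot_iff_le_centralizer]
    refine hm.trans (Subgroup.le_centralizer_iff.1 ?_)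
    exact commutator_le_centralizer_of_isCyclic B

theorem HasInvariantPrimeSections.isNilpotent_commutator [Finite G] [Group.IsSolvable G]
    (hG : HasInvariantPrimeSections G) : Group.IsNilpotent (commutator G) :=
  isNilpotent_commutator_aux _ G rfl hG

/-- The Sylow subgroup `P` contains `G'`, so it is normal. Conjugation by `x` is a nontrivial power
automorphism of `P`, so `P` is abelian and normalises `B`. -/
theorem HasInvariantPrimeSections.normal_of_isPGroup_commutator [Finite G]
    (hG : HasInvariantPrimeSections G) {p : ℕ} [hp : Fact p.Prime]
    (hc : IsPGroup p (commutator G)) {N B : Subgroup G} [N.Normal] (hN : IsPGroup p N) {x : G}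
    {n : ℕ} (hn : p.Coprime n) (hx : x ^ n = 1) (hxN : ∃ v ∈ N, x * v * x⁻¹ ≠ v) (hB : B ≤ N) :
    B.Normal := by
  obtain ⟨P⟩ : Nonempty (Sylow p G) := inferInstance
  have hcP : commutator G ≤ P := hc.le_sylow_of_normal P
  have hPn : (P : Subgroup G).Normal := by
    refine ⟨fun a ha g => ?_⟩
    have h1 : ⁅g, a⁆ ∈ P := hcP (Subgroup.commutator_mem_commutator (Subgroup.mem_top g)
      (Subgroup.mem_top a))
    have := (P : Subgroup G).mul_mem h1 ha
    rwa [commutatorElement_def, inv_mul_cancel_right] at this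
  have hNP : N ≤ P := hN.le_sylow_of_normal P
  let φ : MulAut P := MulAut.conjNormal (H := (P : Subgroup G)) x
  have hφ : ∀ a : P, ((φ a : P) : G) = x * a * x⁻¹ := fun a => rfl
  have hcomm := commute_of_power_automorphism P.isPGroup' φ hn
    (by rw [← map_pow, hx, map_one])
    (by
      intro h
      obtain ⟨v, hv, hne⟩ := hxN
      refine hne ?_
      rw [← hφ ⟨v, hNP hv⟩, h]
      rfl)
    (by
      intro a
      have := hG.conj_mem_of_le P.isPGroup' (Subgroup.zpowers_le.2 a.2) hn hx
        (Subgroup.mem_zpowers (a : G))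
      obtain ⟨i, hi⟩ := this
      exact ⟨i, Subtype.ext (by simpa [hφ] using hi)⟩)
  refine normal_of_conj_mem hp.out P ?_ fun y m hm hy b hb => hG.conj_mem_of_le hN hB hm hy hb
  intro g hg b hb
  have := congrArg Subtype.val (hcomm ⟨g, hg⟩ ⟨b, hNP (hB hb)⟩)
  have h1 : g * b = b * g := this
  rwa [h1, mul_inv_cancel_right]

theorem eq_one_of_isPGroup_of_torsionFree {p : ℕ} {N K : Subgroup G} (hN : IsPGroup p N)
    (hK : ∀ y ∈ K, y ^ p = 1 → y = 1) {a : G} (haN : a ∈ N) (haK : a ∈ K) : a = 1 := by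
  obtain ⟨k, hk⟩ := isPGroup_subgroup_iff.1 hN a haN
  induction k with
  | zero => simpa using hk
  | succ k ih => exact ih (hK _ (K.pow_mem haK _) (by rwa [← pow_mul, ← pow_succ]))

/-- If `G'` is nilpotent, then modulo a normal `p'`-subgroup it is a `p`-group. -/
theorem exists_normal_isPGroup_commutator_quotient [Finite G] {p : ℕ} [hp : Fact p.Prime]
    (hG : Group.IsNilpotent (commutator G)) :
    ∃ (K : Subgroup G) (_ : K.Normal), (∀ y ∈ K, y ^ p = 1 → y = 1) ∧
      IsPGroup p (commutator (G ⧸ K)) := by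
  -- With `K` maximal, a nontrivial normal `q`-subgroup of `G / K`, `q ≠ p`, would pull back to a
  -- larger normal subgroup without elements of order `p`.
  obtain ⟨K, ⟨hK, hKp⟩, hmax⟩ := (Set.toFinite
    {K : Subgroup G | K.Normal ∧ ∀ y ∈ K, y ^ p = 1 → y = 1}).exists_maximal
      ⟨⊥, inferInstance, fun y hy _ => Subgroup.mem_bot.1 hy⟩
  refine ⟨K, hK, hKp, ?_⟩
  have hnil : Group.IsNilpotent (commutator (G ⧸ K)) := by
    rw [Subgroup.isNilpotent_iff_lowerCentralSeries] at hG ⊢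
    obtain ⟨m, hm⟩ := hG
    refine ⟨m, ?_⟩
    rw [← map_commutator_of_surjective (QuotientGroup.mk'_surjective K),
      ← Subgroup.map_lowerCentralSeries, hm, Subgroup.map_bot]
  refine IsPGroup.of_card (Nat.eq_prime_pow_of_unique_prime_dvd Nat.card_pos.ne' ?_)
  intro q hq hd
  by_contra hqp
  have := Fact.mk hq
  obtain ⟨N, hN, hNq, -, -, hne⟩ := exists_normal_isPGroup_le (p := q) (commutator (G ⧸ K))
  refine hne hd ?_
  have hKN : K ≤ N.comap (QuotientGroup.mk' K) := by
    intro y hy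
    have h1 : QuotientGroup.mk' K y = 1 := (QuotientGroup.eq_one_iff y).2 hy
    rw [Subgroup.mem_comap, h1]
    exact N.one_mem
  have hle := hmax (y := N.comap (QuotientGroup.mk' K)) ⟨inferInstance, ?_⟩ hKN
  · rw [eq_bot_iff]
    intro y hy
    obtain ⟨y, rfl⟩ := QuotientGroup.mk'_surjective K y
    exact (QuotientGroup.eq_one_iff y).2 (hle hy)
  · intro y hy hyp
    refine hKp y ?_ hyp
    obtain ⟨k, hk⟩ := isPGroup_subgroup_iff.1 hNq _ hy
    rw [← map_pow, QuotientGroup.mk'_apply] at hk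
    rw [← QuotientGroup.eq_one_iff, ← orderOf_eq_one_iff]
    have h1 : orderOf (y : G ⧸ K) ∣ p :=
      orderOf_dvd_of_pow_eq_one (by rw [← QuotientGroup.mk_pow, hyp]; rfl)
    have h2 : orderOf (y : G ⧸ K) ∣ q ^ k := orderOf_dvd_of_pow_eq_one hk
    have h3 : p.Coprime (q ^ k) := ((Nat.coprime_primes hp.out hq).2 (Ne.symm hqp)).pow_right k
    exact Nat.dvd_one.1 (h3 ▸ Nat.dvd_gcd h1 h2)

theorem normal_of_map_normal {N B K : Subgroup G} [N.Normal] [K.Normal] (hB : B ≤ N)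
    (hNK : ∀ a ∈ N, a ∈ K → a = 1) (h : (B.map (QuotientGroup.mk' K)).Normal) : B.Normal := by
  refine ⟨fun b hb g => ?_⟩
  obtain ⟨c, hc, he⟩ := h.conj_mem _ ⟨b, hb, rfl⟩ (QuotientGroup.mk' K g)
  have h1 : c⁻¹ * (g * b * g⁻¹) ∈ K := QuotientGroup.eq.1 he
  have h2 := hNK _ (N.mul_mem (N.inv_mem (hB hc))
    (Subgroup.Normal.conj_mem inferInstance b (hB hb) g)) h1
  rw [← inv_mul_eq_one.1 h2]
  exact hc

/-- If some element of order prime to `p` acts nontrivially on the normal `p`-subgroup `N`, then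
every subgroup of `N` is normal. -/
theorem HasInvariantPrimeSections.normal_of_le [Finite G] [Group.IsSolvable G]
    (hG : HasInvariantPrimeSections G) {p : ℕ} [hp : Fact p.Prime]
    {N B : Subgroup G} [N.Normal] (hN : IsPGroup p N) {x : G}
    {n : ℕ} (hn : p.Coprime n) (hx : x ^ n = 1) (hxN : ∃ v ∈ N, x * v * x⁻¹ ≠ v) (hB : B ≤ N) :
    B.Normal := by
  obtain ⟨K, hK, hKp, hc⟩ :=
    exists_normal_isPGroup_commutator_quotient (p := p) hG.isNilpotent_commutator
  let f := QuotientGroup.mk' K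
  have hf : Function.Surjective f := QuotientGroup.mk'_surjective K
  have hNK : ∀ a ∈ N, a ∈ K → a = 1 := fun a ha haK =>
    eq_one_of_isPGroup_of_torsionFree hN hKp ha haK
  refine normal_of_map_normal hB hNK ?_
  have : (N.map f).Normal := Subgroup.Normal.map inferInstance f hf
  refine (hG.of_surjective hf).normal_of_isPGroup_commutator hc (hN.map f) (x := f x) hn
    (by rw [← map_pow, hx, map_one]) ?_ (Subgroup.map_mono hB)
  obtain ⟨v, hv, hne⟩ := hxN
  refine ⟨f v, ⟨v, hv, rfl⟩, fun he => hne ?_⟩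
  rw [← map_mul, ← map_inv, ← map_mul] at he
  have h1 : v⁻¹ * (x * v * x⁻¹) ∈ K := QuotientGroup.eq.1 he.symm
  exact (inv_mul_eq_one.1 (hNK _ (N.mul_mem (N.inv_mem hv)
    (Subgroup.Normal.conj_mem inferInstance v hv x)) h1)).symm

end InvariantSections

/-! ### Invariance of prime sections is equivalent to the PST property. -/

section SPermutable

variable {G : Type*} [Group G]

theorem exists_lowerCentralSeries_stable [Finite G] (S : Subgroup G) :
    ∃ n, ∀ m, n ≤ m → S.lowerCentralSeries m = S.lowerCentralSeries n := by
  obtain ⟨n, hn⟩ := WellFoundedGT.monotone_chain_condition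
    (⟨fun i => OrderDual.toDual (S.lowerCentralSeries i), fun i j h =>
      S.lowerCentralSeries_antitone h⟩ : ℕ →o (Subgroup G)ᵒᵈ)
  exact ⟨n, fun m hm => (OrderDual.toDual.injective (hn m hm)).symm⟩

/-- Every subgroup of the nilpotent residual is normal. -/
theorem HasInvariantPrimeSections.normal_of_le_residual [Finite G] [Group.IsSolvable G]
    (hG : HasInvariantPrimeSections G) {B : Subgroup G}
    (hB : ∀ n, B ≤ (⊤ : Subgroup G).lowerCentralSeries n) : B.Normal := by
  refine normal_of_forall_prime_pow_zpowers_normal fun q hq y hy hk => ?_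
  have := Fact.mk hq
  have := hG.isNilpotent_commutator
  obtain ⟨K, hK, hKq, hc⟩ := exists_normal_isPGroup_commutator_quotient (p := q) this
  obtain ⟨N, hN, hNq, -, hyN, -⟩ := exists_normal_isPGroup_le (p := q) (commutator G)
  replace hyN : y ∈ N := hyN y (hB 1 hy) hk
  have hNK : ∀ a ∈ N, a ∈ K → a = 1 := fun a ha haK =>
    eq_one_of_isPGroup_of_torsionFree hNq hKq ha haK
  let f := QuotientGroup.mk' K
  have hf : Function.Surjective f := QuotientGroup.mk'_surjective K
  have hfy : ∀ n, f y ∈ (⊤ : Subgroup (G ⧸ K)).lowerCentralSeries n := by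
    intro n
    have h1 := Subgroup.mem_map_of_mem f (hB n hy)
    rwa [Subgroup.map_lowerCentralSeries, Subgroup.map_top_of_surjective f hf] at h1
  let D := (⊤ : Subgroup (G ⧸ K)).lowerCentralSeries 1
  -- Either some `q'`-element acts nontrivially on `D = (G / K)'`, or `D` is hypercentral; then `G /
  -- K` is nilpotent and its residual, which contains `f y`, is trivial.
  by_cases hx : ∃ (x : G ⧸ K) (m : ℕ), q.Coprime m ∧ x ^ m = 1 ∧ ∃ v ∈ D, x * v * x⁻¹ ≠ v
  · obtain ⟨x, m, hm, hxm, hxv⟩ := hx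
    refine normal_of_map_normal (Subgroup.zpowers_le.2 hyN) hNK ?_
    rw [MonoidHom.map_zpowers]
    exact (hG.of_surjective hf).normal_of_isPGroup_commutator hc hc hm hxm hxv
      (Subgroup.zpowers_le.2 (hfy 1))
  · push Not at hx
    have hD : D ≤ hypercenter (G ⧸ K) := le_hypercenter_of_centralized hc hx
    obtain ⟨n, hn⟩ := (Subgroup.isNilpotent_iff_lowerCentralSeries _).1
      (isNilpotent_of_lowerCentralSeries_le_hypercenter hD)
    have h1 : f y = 1 := by
      have := hfy n
      rwa [hn, Subgroup.mem_bot] at this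
    have h2 : y = 1 := hNK y hyN ((QuotientGroup.eq_one_iff y).1 h1)
    rw [h2, Subgroup.zpowers_one_eq_bot]
    infer_instance

/-- `P` normalises the subgroup `W` generated by the elements of `A` of prime power order for primes
other than `p`, while the `p`-elements of `A` already lie in `P`. Hence `AP = WP` is a subgroup. -/
theorem HasInvariantPrimeSections.isSPermutable_of_isNilpotent [Finite G]
    (hG : HasInvariantPrimeSections G) {A : Subgroup G} (hA : A.IsSubnormal)
    [Group.IsNilpotent A] : IsSPermutable A := by
  intro p hp P
  have := Fact.mk hp
  have hsub : ∀ a ∈ A, (Subgroup.zpowers a).IsSubnormal := fun a ha =>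
    isSubnormal_of_le_isNilpotent (Subgroup.zpowers_le.2 ha) hA
  let X : Set G := {a | a ∈ A ∧ ∃ q : ℕ, q.Prime ∧ q ≠ p ∧ ∃ k : ℕ, a ^ q ^ k = 1}
  let W := Subgroup.closure X
  have hWA : W ≤ A := (Subgroup.closure_le A).2 fun a ha => ha.1
  have hconj : ∀ y ∈ P, ∀ w ∈ W, y * w * y⁻¹ ∈ W := by
    intro y hy
    have : W ≤ W.comap (MulAut.conj y).toMonoidHom := by
      refine (Subgroup.closure_le _).2 ?_
      rintro a ⟨ha, q, hq, hqp, k, hk⟩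
      obtain ⟨l, hl⟩ := isPGroup_subgroup_iff.1 P.isPGroup' y hy
      have h1 := hG.conj_mem hq (hsub a ha) (isPGroup_zpowers hk)
        (((Nat.coprime_primes hq hp).2 hqp).pow_right l) hl (Subgroup.mem_zpowers a)
      have h2 : Subgroup.zpowers a ≤ W :=
        Subgroup.zpowers_le.2 (Subgroup.subset_closure ⟨ha, q, hq, hqp, k, hk⟩)
      exact h2 h1
    exact fun w hw => this hw
  have hPW : (P : Subgroup G) ≤ Subgroup.normalizer (W : Set G) := le_normalizer_of_conj_mem hconj
  have hAWP : A ≤ W ⊔ P := by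
    refine le_of_prime_pow_elements_mem fun q hq y hy hk => ?_
    by_cases hqp : q = p
    · subst hqp
      obtain ⟨k, hk⟩ := hk
      obtain ⟨V, hV, hVp, hle⟩ :=
        exists_normal_isPGroup_of_isSubnormal (hsub y hy) (isPGroup_zpowers hk)
      exact Subgroup.mem_sup_right (hVp.le_sylow_of_normal P (hle (Subgroup.mem_zpowers y)))
    · exact Subgroup.mem_sup_left (Subgroup.subset_closure ⟨hy, q, hq, hqp, hk⟩)
  have hWP : ((W ⊔ (P : Subgroup G) : Subgroup G) : Set G) = (W : Set G) * (P : Set G) :=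
    Subgroup.coe_mul_of_right_le_normalizer_left W P hPW
  have hle : A ⊔ P ≤ W ⊔ P := sup_le hAWP le_sup_right
  have key : ((A ⊔ (P : Subgroup G) : Subgroup G) : Set G) = (A : Set G) * (P : Set G) := by
    refine Set.Subset.antisymm ?_ ?_
    · intro g hg
      have := hle hg
      rw [← SetLike.mem_coe, hWP] at this
      obtain ⟨w, hw, y, hy, rfl⟩ := this
      exact ⟨w, hWA hw, y, hy, rfl⟩
    · rintro _ ⟨a, ha, y, hy, rfl⟩
      exact Subgroup.mul_mem_sup ha hy
  have key' := congrArg (·⁻¹) key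
  simp only [mul_inv_rev, inv_coe_set] at key'
  rw [← key, key']

theorem IsSPermutable.of_map [Finite G] {R A : Subgroup G} [R.Normal] (hRA : R ≤ A)
    (h : IsSPermutable (A.map (QuotientGroup.mk' R))) : IsSPermutable A := by
  intro p hp P
  have := Fact.mk hp
  let f := QuotientGroup.mk' R
  have hf : Function.Surjective f := QuotientGroup.mk'_surjective R
  have hP := h p hp (P.mapSurjective hf)
  have key : (A : Set G) * (P : Set G) ⊆ (P : Set G) * (A : Set G) := by
    rintro _ ⟨a, ha, y, hy, rfl⟩
    have h1 : f a * f y ∈ ((P.mapSurjective hf : Subgroup (G ⧸ R)) : Set (G ⧸ R)) *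
        ((A.map f : Subgroup (G ⧸ R)) : Set (G ⧸ R)) := by
      have : f a * f y ∈ ((A.map f : Subgroup (G ⧸ R)) : Set (G ⧸ R)) *
          ((P.mapSurjective hf : Subgroup (G ⧸ R)) : Set (G ⧸ R)) :=
        Set.mul_mem_mul ⟨a, ha, rfl⟩ ⟨y, hy, rfl⟩
      exact hP.le this
    obtain ⟨_, ⟨z, hz, rfl⟩, _, ⟨b, hb, rfl⟩, he⟩ := h1
    have he' : f (z * b) = f (a * y) := by rw [map_mul, map_mul]; exact he
    have h2 : (z * b)⁻¹ * (a * y) ∈ R := QuotientGroup.eq.1 he'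
    refine ⟨z, hz, b * ((z * b)⁻¹ * (a * y)), A.mul_mem hb (hRA h2), ?_⟩
    simp only
    group
  refine Set.Subset.antisymm key ?_
  have h3 := Set.inv_subset_inv.2 key
  simp only [mul_inv_rev, inv_coe_set] at h3
  exact h3

/-- The nilpotent residual `R` of `A` lies in that of `G`, so it is normal in `G`, and `A / R` is
nilpotent. -/
theorem HasInvariantPrimeSections.isPSTGroup [Finite G] [Group.IsSolvable G]
    (hG : HasInvariantPrimeSections G) : IsPSTGroup G := by
  intro A hA
  obtain ⟨n, hn⟩ := exists_lowerCentralSeries_stable A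
  let R := A.lowerCentralSeries n
  have hR : R.Normal := by
    refine hG.normal_of_le_residual fun m => ?_
    have h1 : R ≤ A.lowerCentralSeries m := by
      rw [show R = A.lowerCentralSeries (max n m) from (hn _ (le_max_left n m)).symm]
      exact A.lowerCentralSeries_antitone (le_max_right n m)
    exact h1.trans (Subgroup.lowerCentralSeries_mono m le_top)
  have hf := QuotientGroup.mk'_surjective R
  refine IsSPermutable.of_map (R := R) (A.lowerCentralSeries_le_self n) ?_
  have : Group.IsNilpotent (A.map (QuotientGroup.mk' R)) := by
    refine Subgroup.isNilpotent_of_lowerCentralSeries_eq_bot (n := n) ?_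
    rw [← Subgroup.map_lowerCentralSeries, Subgroup.map_eq_bot_iff, QuotientGroup.ker_mk']
  exact (hG.of_surjective hf).isSPermutable_of_isNilpotent (hA.map hf)

theorem IsPSTGroup.of_surjective [Finite G] {H : Type*} [Group H] (hG : IsPSTGroup G) {f : G →* H}
    (hf : Function.Surjective f) : IsPSTGroup H := by
  intro A hA p hp P
  have := Fact.mk hp
  obtain ⟨Q, rfl⟩ := Sylow.mapSurjective_surjective hf p P
  have h1 := congrArg (f '' ·) (hG (A.comap f) (hA.comap f) p hp Q)
  simp only [Set.image_mul] at h1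
  have h2 : f '' (A.comap f : Set G) = A := by
    rw [Subgroup.coe_comap, Set.image_preimage_eq _ hf]
  rw [h2] at h1
  exact h1

/-- For a Sylow `q`-subgroup `Q`, `q ≠ p`, permutability writes `y * c = d * w`. Then `d⁻¹ * (y * c
* y⁻¹) = w * y⁻¹` lies both in `Q` and in a normal `p`-subgroup, so it is trivial. -/
theorem IsPSTGroup.conj_mem [Finite G] (hG : IsPSTGroup G) {p : ℕ} [hp : Fact p.Prime]
    {B : Subgroup G} (hB : B.IsSubnormal) (hpB : IsPGroup p B) {x : G} {n : ℕ}
    (hn : p.Coprime n) (hx : x ^ n = 1) {b : G} (hb : b ∈ B) : x * b * x⁻¹ ∈ B := by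
  suffices Subgroup.zpowers x ≤ Subgroup.normalizer (B : Set G) from
    (Subgroup.mem_normalizer_iff.1 (this (Subgroup.mem_zpowers x)) b).1 hb
  refine le_of_prime_pow_elements_mem ?_
  rintro q hq y ⟨i, rfl⟩ ⟨k, hk⟩
  have := Fact.mk hq
  by_cases hqp : q = p
  · subst hqp
    have h1 : (x ^ i) ^ n = 1 := by
      rw [← zpow_natCast, ← zpow_mul, mul_comm, zpow_mul, zpow_natCast, hx, one_zpow]
    have h2 : orderOf (x ^ i) = 1 := Nat.dvd_one.1 (hn.pow_left k ▸
      Nat.dvd_gcd (orderOf_dvd_of_pow_eq_one hk) (orderOf_dvd_of_pow_eq_one h1))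
    rw [orderOf_eq_one_iff] at h2
    change x ^ i ∈ _
    rw [h2]
    exact Subgroup.one_mem _
  · obtain ⟨Q, hQ⟩ := (isPGroup_zpowers hk).exists_le_sylow
    obtain ⟨V, hV, hVp, hBV⟩ := exists_normal_isPGroup_of_isSubnormal hB hpB
    refine (le_normalizer_of_conj_mem (Q := Q) fun y hy c hc => ?_) (hQ (Subgroup.mem_zpowers _))
    have h1 : y * c ∈ (B : Set G) * (Q : Set G) := by
      rw [hG B hB q hq Q]
      exact Set.mul_mem_mul hy hc
    obtain ⟨d, hd, w, hw, he⟩ := h1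
    replace he : d * w = y * c := he
    have h2 : d⁻¹ * (y * c * y⁻¹) = w * y⁻¹ := by
      rw [← he]; group
    have h3 : d⁻¹ * (y * c * y⁻¹) ∈ V := V.mul_mem (V.inv_mem (hBV hd))
      (hV.conj_mem c (hBV hc) y)
    have h4 : d⁻¹ * (y * c * y⁻¹) ∈ (Q : Subgroup G) := by
      rw [h2]
      exact (Q : Subgroup G).mul_mem hw ((Q : Subgroup G).inv_mem hy)
    have h5 := Subgroup.disjoint_def.1 (hVp.disjoint_of_ne p q (Ne.symm hqp) _ _ Q.isPGroup') h3 h4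
    rw [← inv_mul_eq_one.1 h5]
    exact hd

theorem IsPSTGroup.hasInvariantPrimeSections [Finite G] (hG : IsPSTGroup G) :
    HasInvariantPrimeSections G := by
  intro p hp N B hN hB hNB hpB x n hn hx b hb
  have := Fact.mk hp
  have hf := QuotientGroup.mk'_surjective N
  obtain ⟨c, hc, he⟩ := (hG.of_surjective hf).conj_mem (hB.map hf)
    (isPGroup_quotient_iff.2 hpB) (x := QuotientGroup.mk' N x) hn
    (by rw [← map_pow]; exact (QuotientGroup.eq_one_iff _).2 hx) ⟨b, hb, rfl⟩
  have h1 : c⁻¹ * (x * b * x⁻¹) ∈ N := QuotientGroup.eq.1 he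
  have := B.mul_mem hc (hNB h1)
  rwa [mul_inv_cancel_left] at this

end SPermutable

/-! ### Hypercentral sections and central chief factors. -/

namespace NormalSection

variable {G : Type*} [Group G]

theorem nonempty_quot_mulEquiv_image (S : NormalSection G) : Nonempty (S.Quot ≃* S.image) := by
  let g : S.top →* S.image := (QuotientGroup.mk' S.bot).subgroupMap S.top
  have hg : Function.Surjective g := (QuotientGroup.mk' S.bot).subgroupMap_surjective S.top
  have hker : S.bot.subgroupOf S.top = g.ker := by
    ext x
    rw [Subgroup.mem_subgroupOf, MonoidHom.mem_ker, Subtype.ext_iff]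
    exact (QuotientGroup.eq_one_iff (x : G)).symm
  exact ⟨(QuotientGroup.quotientMulEquivOfEq hker).trans
    (QuotientGroup.quotientKerEquivOfSurjective g hg)⟩

theorem isNilpotent_quot_iff (S : NormalSection G) :
    Group.IsNilpotent S.Quot ↔ Group.IsNilpotent S.image :=
  Group.isNilpotent_congr S.nonempty_quot_mulEquiv_image.some

instance image_normal (S : NormalSection G) : S.image.Normal :=
  Subgroup.Normal.map S.top_normal _ (QuotientGroup.mk'_surjective _)

theorem image_le_iff (S : NormalSection G) {H : Subgroup (G ⧸ S.bot)} :
    S.image ≤ H ↔ S.top ≤ H.comap (QuotientGroup.mk' S.bot) :=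
  Subgroup.map_le_iff_le_comap

theorem isNilpotent_quot_of_image_le_hypercenter [Finite G] (S : NormalSection G)
    (h : S.image ≤ hypercenter (G ⧸ S.bot)) : Group.IsNilpotent S.Quot :=
  S.isNilpotent_quot_iff.2 (isNilpotent_of_lowerCentralSeries_le_hypercenter (n := 0) h)

theorem image_le_hypercenter_of_leZ [Finite G] (S : NormalSection G)
    (h : S.LeZ (centralChiefFactors G)) : S.image ≤ hypercenter (G ⧸ S.bot) := by
  rw [image_le_iff]
  set Z := (hypercenter (G ⧸ S.bot)).comap (QuotientGroup.mk' S.bot) with hZ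
  have hbotZ : S.bot ≤ Z := by
    intro x hx
    rw [hZ, Subgroup.mem_comap, show QuotientGroup.mk' S.bot x = 1 from
      (QuotientGroup.eq_one_iff x).2 hx]
    exact Subgroup.one_mem _
  rcases h with h | ⟨-, h⟩
  · rwa [← h]
  by_contra hne
  -- A chief factor directly above the hypercentral part `K` of the section is central, which would
  -- enlarge `K`.
  let K := Z ⊓ S.top
  have hK : K.Normal := inferInstance
  obtain ⟨H, ⟨hH, hKH, hHtop⟩, hmin⟩ := (Set.toFinite
    {H : Subgroup G | H.Normal ∧ K < H ∧ H ≤ S.top}).exists_minimal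
      ⟨S.top, S.top_normal, inf_le_right.lt_of_ne fun he => hne (inf_eq_right.1 he), le_rfl⟩
  let C : NormalSection G := ⟨H, K, hH, hK, hKH.le⟩
  have hC : C.IsChiefFactor := by
    refine ⟨hKH, fun N hN hKN hNH => ?_⟩
    rcases eq_or_lt_of_le hKN with he | hlt
    · exact Or.inl he.symm
    · exact Or.inr (le_antisymm hNH (hmin ⟨hN, hlt, hNH.trans hHtop⟩ hNH))
  have hcen := (h C hC (le_inf hbotZ S.bot_le_top) hHtop).2
  refine hKH.not_ge (le_inf (fun x hx => ?_) hHtop)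
  refine mem_hypercenter_of_commutator_mem fun y => ?_
  obtain ⟨y, rfl⟩ := QuotientGroup.mk'_surjective S.bot y
  have h1 := Subgroup.mem_center_iff.1 (hcen ⟨x, hx, rfl⟩) (QuotientGroup.mk' K y)
  have h2 : x * y * x⁻¹ * y⁻¹ ∈ K := by
    rw [← QuotientGroup.eq_one_iff (N := K)]
    change QuotientGroup.mk' K (x * y * x⁻¹ * y⁻¹) = 1
    rw [map_mul, map_mul, map_mul, map_inv, map_inv]
    refine mul_inv_eq_one.2 (mul_inv_eq_iff_eq_mul.2 h1.symm)
  have h3 : x * y * x⁻¹ * y⁻¹ ∈ Z := h2.1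
  rw [hZ, Subgroup.mem_comap] at h3
  simpa only [map_mul, map_inv] using h3

theorem leZ_of_image_le_hypercenter (S : NormalSection G)
    (h : S.image ≤ hypercenter (G ⧸ S.bot)) : S.LeZ (centralChiefFactors G) := by
  classical
  rcases eq_or_lt_of_le S.bot_le_top with he | hlt
  · exact Or.inl he
  refine Or.inr ⟨hlt, fun C hC hbot htop => ⟨hC, ?_⟩⟩
  let Z : ℕ → Subgroup G := fun i =>
    (Subgroup.upperCentralSeries (G ⧸ S.bot) i).comap (QuotientGroup.mk' S.bot)
  -- At the least such `i`, the subgroup `C.top ⊓ Z i` covers the chief factor, and its commutators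
  -- with `G` fall into `C.top ⊓ Z (i - 1) ≤ C.bot`.
  have hex : ∃ i, ¬ C.top ⊓ Z i ≤ C.bot := by
    obtain ⟨x, hx, hxK⟩ := SetLike.exists_of_lt hC.1
    obtain ⟨i, hi⟩ := mem_hypercenter_iff.1 (S.image_le_iff.1 h (htop hx))
    exact ⟨i, fun hle => hxK (hle ⟨hx, hi⟩)⟩
  have hspec := Nat.find_spec hex
  have hmin := fun m => Nat.find_min hex (m := m)
  set i := Nat.find hex with hi
  rcases i with _ | j
  · refine absurd (fun x hx => ?_) hspec
    have h1 : QuotientGroup.mk' S.bot x ∈ Subgroup.upperCentralSeries (G ⧸ S.bot) 0 := hx.2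
    rw [Subgroup.upperCentralSeries_zero, Subgroup.mem_bot] at h1
    exact hbot ((QuotientGroup.eq_one_iff x).1 h1)
  have hj : C.top ⊓ Z j ≤ C.bot := not_not.1 (hmin j (Nat.lt_succ_self j))
  have htopeq : (C.top ⊓ Z (j + 1)) ⊔ C.bot = C.top := by
    rcases hC.2 ((C.top ⊓ Z (j + 1)) ⊔ C.bot) inferInstance le_sup_right
      (sup_le inf_le_left C.bot_le_top) with h1 | h1
    · exact absurd (sup_eq_right.1 h1) hspec
    · exact h1
  rw [IsCentral, image_le_iff, ← htopeq]
  refine sup_le ?_ ?_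
  · rintro x ⟨hx, hxZ⟩
    rw [Subgroup.mem_comap, Subgroup.mem_center_iff]
    intro y
    obtain ⟨y, rfl⟩ := QuotientGroup.mk'_surjective C.bot y
    have h1 : ⁅x, y⁆ ∈ C.top := by
      rw [commutatorElement_def, mul_assoc, mul_assoc, ← mul_assoc y]
      exact C.top.mul_mem hx (C.top_normal.conj_mem _ (C.top.inv_mem hx) y)
    have h2 : ⁅x, y⁆ ∈ Z j := by
      have := Subgroup.mem_upperCentralSeries_succ_iff.1 hxZ (QuotientGroup.mk' S.bot y)
      rwa [← map_commutatorElement] at this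
    have h3 : QuotientGroup.mk' C.bot ⁅x, y⁆ = 1 := (QuotientGroup.eq_one_iff _).2 (hj ⟨h1, h2⟩)
    rw [map_commutatorElement, commutatorElement_eq_one_iff_mul_comm] at h3
    exact h3.symm
  · intro x hx
    rw [Subgroup.mem_comap, show QuotientGroup.mk' C.bot x = 1 from
      (QuotientGroup.eq_one_iff x).2 hx]
    exact Subgroup.one_mem _

end NormalSection

/-! ### Nilpotent sections `A^G / A_G` and the equivalences. -/

section NilpotentClosureModCore

variable {G : Type*} [Group G]

/-- Since `N ≤ B_G`, the section `B^G / B_G` is a `p`-group, hence hypercentral and centralised by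
`x`; conjugation by `x` moves `b` only within `b B_G`. -/
theorem hasInvariantPrimeSections_of_image_le_hypercenter [Finite G]
    (h : ∀ A : Subgroup G, Group.IsNilpotent (closureModCore A).Quot →
      (closureModCore A).image ≤ hypercenter (G ⧸ (closureModCore A).bot)) :
    HasInvariantPrimeSections G := by
  intro p hp N B hN hB hNB hpB x n hn hx b hb
  have := Fact.mk hp
  have hNcore : N ≤ (closureModCore B).bot := Subgroup.normal_le_normalCore.2 hNB
  obtain ⟨M, hM, hMp, hBM⟩ := exists_normal_isPGroup_of_isSubnormal
    (hB.map (QuotientGroup.mk'_surjective N)) (isPGroup_quotient_iff.2 hpB)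
  have hclo : (closureModCore B).top ≤ M.comap (QuotientGroup.mk' N) :=
    Subgroup.normalClosure_le_normal (Subgroup.map_le_iff_le_comap.1 hBM)
  have himage : IsPGroup p (closureModCore B).image := by
    refine isPGroup_quotient_iff.2 fun c hc => ?_
    obtain ⟨k, hk⟩ := isPGroup_subgroup_iff.1 hMp _ (hclo hc)
    rw [← map_pow] at hk
    exact ⟨k, hNcore ((QuotientGroup.eq_one_iff _).1 hk)⟩
  have hle := h B ((closureModCore B).isNilpotent_quot_iff.2 himage.isNilpotent)
  have hbi : QuotientGroup.mk' (closureModCore B).bot b ∈ (closureModCore B).image :=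
    ⟨b, Subgroup.le_normalClosure hb, rfl⟩
  have h1 := commute_of_mem_hypercenter himage hbi (hle hbi)
    (x := QuotientGroup.mk' (closureModCore B).bot x) hn
    (by rw [← map_pow]; exact (QuotientGroup.eq_one_iff _).2 (hNcore hx))
  rw [← map_mul, ← map_inv, ← map_mul] at h1
  have h2 : b⁻¹ * (x * b * x⁻¹) ∈ (closureModCore B).bot := QuotientGroup.eq.1 h1.symm
  have := B.mul_mem hb (B.normalCore_le h2)
  rwa [mul_inv_cancel_left] at this

theorem HasInvariantPrimeSections.image_le_hypercenter [Finite G] [Group.IsSolvable G]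
    (hG : HasInvariantPrimeSections G) (A : Subgroup G)
    (hA : Group.IsNilpotent (closureModCore A).Quot) :
    (closureModCore A).image ≤ hypercenter (G ⧸ (closureModCore A).bot) := by
  rw [NormalSection.isNilpotent_quot_iff] at hA
  rw [NormalSection.image_le_iff]
  let L := (closureModCore A).bot
  let f := QuotientGroup.mk' L
  have hf : Function.Surjective f := QuotientGroup.mk'_surjective L
  have hLA : L ≤ A := A.normalCore_le
  refine Subgroup.normalClosure_le_normal (N := (hypercenter (G ⧸ L)).comap f) ?_
  refine le_of_prime_pow_elements_mem fun q hq y hy ⟨k, hk⟩ => ?_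
  have := Fact.mk hq
  obtain ⟨N, hN, hNq, -, hmem, -⟩ := exists_normal_isPGroup_le (p := q) (closureModCore A).image
  have hyN : f y ∈ N := hmem _ ⟨y, Subgroup.le_normalClosure hy, rfl⟩
    ⟨k, by rw [← map_pow, hk, map_one]⟩
  rw [Subgroup.mem_comap]
  by_cases hx : ∃ (x : G ⧸ L) (m : ℕ), q.Coprime m ∧ x ^ m = 1 ∧ ∃ v ∈ N, x * v * x⁻¹ ≠ v
  · obtain ⟨x, m, hm, hxm, hxv⟩ := hx
    have hnorm := (hG.of_surjective hf).normal_of_le hNq hm hxm hxv (Subgroup.zpowers_le.2 hyN)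
    -- This preimage is a normal subgroup of `G` inside `A`, so it lies in the core.
    have hle : (Subgroup.zpowers (f y)).comap f ≤ A := by
      rw [← MonoidHom.map_zpowers, Subgroup.comap_map_eq, QuotientGroup.ker_mk']
      exact sup_le (Subgroup.zpowers_le.2 hy) hLA
    have hyL : y ∈ L :=
      Subgroup.normal_le_normalCore.2 hle (Subgroup.mem_zpowers (f y))
    rw [show f y = 1 from (QuotientGroup.eq_one_iff y).2 hyL]
    exact Subgroup.one_mem _
  · push Not at hx
    exact le_hypercenter_of_centralized hNq hx hyN

theorem isPSTGroup_iff_image_le_hypercenter [Finite G] [Group.IsSolvable G] :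
    IsPSTGroup G ↔ ∀ A : Subgroup G, Group.IsNilpotent (closureModCore A).Quot →
      (closureModCore A).image ≤ hypercenter (G ⧸ (closureModCore A).bot) :=
  ⟨fun h => h.hasInvariantPrimeSections.image_le_hypercenter,
    fun h => (hasInvariantPrimeSections_of_image_le_hypercenter h).isPSTGroup⟩

theorem latticeOfNilpotent_eq_latticeOfSections_iff [Finite G] :
    latticeOfNilpotent G = latticeOfSections G (centralChiefFactors G) ↔
      ∀ A : Subgroup G, Group.IsNilpotent (closureModCore A).Quot →
        (closureModCore A).image ≤ hypercenter (G ⧸ (closureModCore A).bot) := by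
  constructor
  · intro h A hA
    have h1 : A ∈ latticeOfSections G (centralChiefFactors G) := h ▸ hA
    exact (closureModCore A).image_le_hypercenter_of_leZ h1
  · intro h
    ext A
    exact ⟨fun hA => (closureModCore A).leZ_of_image_le_hypercenter (h A hA), fun hA =>
      (closureModCore A).isNilpotent_quot_of_image_le_hypercenter
        ((closureModCore A).image_le_hypercenter_of_leZ hA)⟩

end NilpotentClosureModCore

theorem theorem1p5 (G : Type*) [Group G] [Finite G] [Group.IsSolvable G] :
    (IsPSTGroup G ↔ latticeOfNilpotent G = latticeOfSections G (centralChiefFactors G)) ∧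
    (IsPSTGroup G ↔
      ∀ A : Subgroup G, Group.IsNilpotent (closureModCore A).Quot →
        (closureModCore A).image ≤ hypercenter (G ⧸ (closureModCore A).bot)) :=
  ⟨isPSTGroup_iff_image_le_hypercenter.trans latticeOfNilpotent_eq_latticeOfSections_iff.symm,
    isPSTGroup_iff_image_le_hypercenter⟩
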